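/- Let $K$ be a commutative ring, let $A$ be a set, let $\theta\subset A\times A$ be an irreflexive symmetric relation, and let $\mathcal M=M(A,\theta)=\langle A\mid ab=ba,\ (a,b)\in\theta\rangle$ be the free partially commutative monoid, whose elements are called traces. For a trace $t$ let $|t|$ be its length and $\mathrm{Alph}(t)$ the set of its letters. For $B\subset A$ and $n\ge 0$ put $B^{\le n}=\{t\in\mathcal M:\mathrm{Alph}(t)\subset B,\ |t|\le n\}$. Let $L_K(A,\theta)$ be the free partially commutative Lie algebra, realised as the Lie subalgebra generated by $A$ in the monoid algebra $K[\mathcal M]$ with the commutator bracket. *Codes and transitive bisections.* For $X\subset\mathcal M$ let $\langle X\rangle$ be the submonoid generated by $X$ and $\theta_X=\{(x,y)\in X^2:\mathrm{Alph}(x)\times\mathrm{Alph}(y)\subset\theta\}$. The set $X$ is a *partially commutative code* if the natural morphism $M(X,\theta_X)\to\mathcal M$ is injective. For a partially commutative code $Y$ and $T\subset Y$ let $\beta_{Y-T}(T)$ be the set of all $t=zw$ with $z\in Y-T$ and $w\in\langle T\rangle$ such that $z$ is the only element of $Y$ that begins $t$, i.e. $\{y\in Y: t\in y\langle Y\rangle\}=\{z\}$.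 If $\beta_{Y-T}(T)$ is a partially commutative code, then $(T,\beta_{Y-T}(T))$ is called a *transitive bisection* of $\langle Y\rangle$. *Finite transitive factorizations.* These are the finite sequences $(Y_1,\dots,Y_{n+1})$ ($n\ge 0$) of subsets of $\mathcal M$ that are obtained from the one-term sequence $(A)$ by $n$ successive steps, each of which replaces one term $Y$ by the two consecutive terms $T,\ \beta_{Y-T}(T)$ of a transitive bisection $\mathcal B$ of $\langle Y\rangle$. For such a sequence $\mathcal F$ put $\mathrm{Cont}\,\mathcal F=\bigcup_i Y_i$, and let $\widetilde{\mathcal F}$ be the set of the sequences $\mathfrak f=(\mathcal B_1,\dots,\mathcal B_n)$ of transitive bisections that produce $\mathcal F$ in this way. The *bracketing* $\Pi_{\mathfrak f}:\mathrm{Cont}\,\mathcal F\to L_K(A,\theta)$ along $\mathfrak f\in\widetilde{\mathcal F}$ is defined by induction on $n$: for $n=0$, $\Pi_{\mathfrak f}(a)=a$ for $a\in A$; for $n\ge 1$, let $\mathfrak f'=(\mathcal B_1,\dots,\mathcal B_{n-1})$, let $\mathcal F'$ be the factorization it produces, and let $\mathcal B_n=(T,\beta_{Y-T}(T))$; then $\Pi_{\mathfrak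 f}=\Pi_{\mathfrak f'}$ on $\mathrm{Cont}\,\mathcal F'$, and $$\Pi_{\mathfrak f}(yv_1\cdots v_k)=[\dots[[\Pi_{\mathfrak f'}(y),\Pi_{\mathfrak f'}(v_1)],\Pi_{\mathfrak f'}(v_2)],\dots,\Pi_{\mathfrak f'}(v_k)]$$ whenever $y\in Y-T$, $v_1,\dots,v_k\in T$ and $yv_1\cdots v_k\in\beta_{Y-T}(T)$. *Locally finite transitive factorizations.* Let $I$ be a totally ordered set and $(Y_i)_{i\in I}$ a family of subsets of $\mathcal M$. It is called a *factorization* of $\mathcal M$ if each $Y_i$ is a minimal generating set of $\langle Y_i\rangle$ and every $m\in\mathcal M$, $m\ne 1$, can be written in exactly one way as $m=m_1\cdots m_k$ with $m_j\in\langle Y_{i_j}\rangle-\{1\}$ and $i_1<\dots<i_k$. A finite transitive factorization $(Y'_1,\dots,Y'_r)$ *agrees with $(Y_i)_{i\in I}$ on $B^{\le n}$* if there is a strictly increasing map $\varphi:\{1,\dots,r\}\to I$ such that $Y'_k\cap B^{\le n}=Y_{\varphi(k)}\cap B^{\le n}$ for all $k$ and $Y_i\cap B^{\le n}=\emptyset$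 for all $i\notin\varphi(\{1,\dots,r\})$. A factorization is *locally finite transitive* if for every finite $B\subset A$ and every $n\ge 0$ some finite transitive factorization agrees with it on $B^{\le n}$. **Theorem.** Let $(Y_i)_{i\in I}$ be a locally finite transitive factorization of $M(A,\theta)$. Then it admits a bracketing, that is, a map $\Pi:\bigcup_{i\in I}Y_i\to L_K(A,\theta)$ such that for every finite $B\subset A$ and every $n\ge 0$ there are a finite transitive factorization $\mathcal F_{n,B}$ that agrees with $(Y_i)_{i\in I}$ on $B^{\le n}$ and a sequence $\mathfrak f_{n,B}\in\widetilde{\mathcal F}_{n,B}$ with $$\Pi(t)=\Pi_{\mathfrak f_{n,B}}(t)\qquad\text{for all } t\in\bigcup_{i\in I}Y_i\cap B^{\le n}=\mathrm{Cont}\,\mathcal F_{n,B}\cap B^{\le n}.$$ -/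

import Mathlib

namespace TraceFact

attribute [local instance] LieRing.ofAssociativeRing

/-- The defining relations `ab = ba`, `(a, b) ∈ θ`, on words. -/
def commRel {A : Type*} (θ : A → A → Prop) (u v : FreeMonoid A) : Prop :=
  ∃ a b : A, θ a b ∧ u = FreeMonoid.of a * FreeMonoid.of b ∧ v = FreeMonoid.of b * FreeMonoid.of a

/-- The free partially commutative monoid `M(A, θ)`; its elements are called traces. -/
abbrev TraceMonoid {A : Type*} (θ : A → A → Prop) : Type _ := PresentedMonoid (commRel θ)

/-- A letter, as a trace. -/
def letter {A : Type*} (θ : A → A → Prop) (a : A) : TraceMonoid θ :=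
  PresentedMonoid.of (commRel θ) a

theorem lift_commRel {A : Type*} {θ : A → A → Prop} {N : Type*} [Monoid N] (f : A → N)
    (hf : ∀ a b, θ a b → f a * f b = f b * f a) :
    ∀ u v : FreeMonoid A, commRel θ u v → FreeMonoid.lift f u = FreeMonoid.lift f v := by
  rintro u v ⟨a, b, hab, rfl, rfl⟩
  simpa using hf a b hab

/-- The universal property: a map from the letters that respects the commutations extends to
a morphism of monoids. -/
def lift {A : Type*} {θ : A → A → Prop} {N : Type*} [Monoid N] (f : A → N)
    (hf : ∀ a b, θ a b → f a * f b = f b * f a) : TraceMonoid θ →* N :=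
  PresentedMonoid.lift f (lift_commRel f hf)

theorem lift_letter {A : Type*} {θ : A → A → Prop} {N : Type*} [Monoid N] (f : A → N)
    (hf : ∀ a b, θ a b → f a * f b = f b * f a) (a : A) : lift f hf (letter θ a) = f a := by
  simp [lift, letter]

/-- The multiset of the letters of a trace, counted with multiplicity. -/
def content {A : Type*} {θ : A → A → Prop} (t : TraceMonoid θ) : Multiset A :=
  Multiplicative.toAdd
    (lift (θ := θ) (fun a : A => Multiplicative.ofAdd ({a} : Multiset A))
      (fun _ _ _ => mul_comm _ _) t)

/-- `Alph(t)`, the set of the letters that occur in `t`. -/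
def alph {A : Type*} {θ : A → A → Prop} (t : TraceMonoid θ) : Set A := {a | a ∈ content t}

/-- The length `|t|` of a trace. -/
def length {A : Type*} {θ : A → A → Prop} (t : TraceMonoid θ) : ℕ := Multiset.card (content t)

/-- `B^{≤ n}`: the traces of length at most `n` whose letters all lie in `B`. -/
def boundedTraces {A : Type*} (θ : A → A → Prop) (B : Set A) (n : ℕ) : Set (TraceMonoid θ) :=
  {t | alph t ⊆ B ∧ length t ≤ n}

/-- `Alph(x) × Alph(y) ⊆ θ`. -/
def Indep {A : Type*} {θ : A → A → Prop} (x y : TraceMonoid θ) : Prop :=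
  ∀ a ∈ alph x, ∀ b ∈ alph y, θ a b

/-- The independence relation `θ_X` on a set `X` of traces. -/
def indepOn {A : Type*} {θ : A → A → Prop} (X : Set (TraceMonoid θ)) (x y : X) : Prop :=
  Indep x.1 y.1

theorem letter_comm {A : Type*} {θ : A → A → Prop} {a b : A} (h : θ a b) :
    letter θ a * letter θ b = letter θ b * letter θ a :=
  PresentedMonoid.mk_eq_mk_of_rel ⟨a, b, h, rfl, rfl⟩

theorem content_one {A : Type*} {θ : A → A → Prop} : content (1 : TraceMonoid θ) = 0 := by
  simp [content]

theorem content_mul {A : Type*} {θ : A → A → Prop} (s t : TraceMonoid θ) :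
    content (s * t) = content s + content t := by
  simp [content]

theorem content_letter {A : Type*} {θ : A → A → Prop} (a : A) :
    content (letter θ a) = {a} := by
  simp [content, lift_letter]

theorem trace_induction {A : Type*} {θ : A → A → Prop} {p : TraceMonoid θ → Prop}
    (h1 : p 1) (hmul : ∀ a t, p t → p (letter θ a * t)) (t : TraceMonoid θ) : p t := by
  induction t using PresentedMonoid.inductionOn with
  | _ w =>
    induction w using FreeMonoid.inductionOn' with
    | one => simpa using h1
    | of_mul a w ih => simpa [letter, PresentedMonoid.of] using hmul a _ ih

theorem Indep.mul_comm {A : Type*} {θ : A → A → Prop} {x y : TraceMonoid θ} (h : Indep x y) :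
    x * y = y * x := by
  have key : ∀ (a : A) (y : TraceMonoid θ), (∀ b ∈ alph y, θ a b) →
      letter θ a * y = y * letter θ a := by
    intro a y
    induction y using trace_induction with
    | h1 => simp
    | hmul b t ih =>
      intro hb
      have h1 : θ a b := hb b (by simp [alph, content_mul, content_letter])
      have h2 := ih (fun c hc => hb c (by
        simp only [alph, Set.mem_ofPred_eq, content_mul, Multiset.mem_add] at hc ⊢
        exact Or.inr hc))
      rw [← mul_assoc, letter_comm h1, mul_assoc, h2, mul_assoc]
  induction x using trace_induction with
  | h1 => simp
  | hmul a t ih =>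
    have h1 := key a y (h a (by simp [alph, content_mul, content_letter]))
    have h2 := ih (fun c hc => h c (by
      simp only [alph, Set.mem_ofPred_eq, content_mul, Multiset.mem_add] at hc ⊢
      exact Or.inr hc))
    rw [mul_assoc, h2, ← mul_assoc, h1, mul_assoc]

/-- The natural morphism from `M(X, θ_X)` to `M(A, θ)`, whose image is the submonoid `⟨X⟩`. -/
def ofCode {A : Type*} {θ : A → A → Prop} (X : Set (TraceMonoid θ)) :
    TraceMonoid (indepOn X) →* TraceMonoid θ :=
  lift (fun x : X => x.1) (fun _ _ h => Indep.mul_comm h)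

/-- `X` is a partially commutative code: every element of `⟨X⟩` has a unique decomposition
over `X` up to the commutations of `θ_X`. -/
def IsCode {A : Type*} {θ : A → A → Prop} (X : Set (TraceMonoid θ)) : Prop :=
  Function.Injective (ofCode X)

/-- The initial letters of `t` with respect to the alphabet `Y`. -/
def initialAlph {A : Type*} {θ : A → A → Prop} (Y : Set (TraceMonoid θ)) (t : TraceMonoid θ) :
    Set (TraceMonoid θ) :=
  {y | y ∈ Y ∧ ∃ w ∈ Submonoid.closure Y, t = y * w}

/-- `β_{Y - T}(T) = {zw | z ∈ Y - T, w ∈ ⟨T⟩, IA(zw) = {z}}`, for a subset `T` of a partially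
commutative code `Y`, where `⟨Y⟩` is seen as the free partially commutative monoid on `Y` and
`IA` refers to the alphabet `Y`. -/
def beta {A : Type*} {θ : A → A → Prop} (Y T : Set (TraceMonoid θ)) : Set (TraceMonoid θ) :=
  {t | ∃ z ∈ Y \ T, ∃ w ∈ Submonoid.closure T, t = z * w ∧ initialAlph Y t = {z}}

/-- `T` is a transitively factorizing subalphabet of `Y`. -/
def IsTFSA {A : Type*} {θ : A → A → Prop} (Y T : Set (TraceMonoid θ)) : Prop :=
  T ⊆ Y ∧ IsCode (beta Y T)

/-- `BisectionSeq θ F` is the set of the finite sequences `(𝓑₁, …, 𝓑ₙ)` of transitive bisections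
with `F = 𝓑ₙ ∘ ⋯ ∘ 𝓑₁`, where `F = (Y₁, …, Yₙ₊₁)`. The empty sequence composes to the
one-term factorization `(A)`; to compose with the bisection `(T, β_{Y - T}(T))` of a factor `⟨Y⟩`
is to replace the term `Y` by the two consecutive terms `T, β_{Y - T}(T)`. -/
inductive BisectionSeq {A : Type*} (θ : A → A → Prop) : List (Set (TraceMonoid θ)) → Type _
  | nil : BisectionSeq θ [Set.range (letter θ)]
  | comp {pre post : List (Set (TraceMonoid θ))} {Y : Set (TraceMonoid θ)}
      (f : BisectionSeq θ (pre ++ Y :: post)) (T : Set (TraceMonoid θ)) (hT : IsTFSA Y T) :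
      BisectionSeq θ (pre ++ T :: beta Y T :: post)

/-- `F` is a finite transitive factorization of `M(A, θ)`: it is composed of finitely many
transitive bisections. -/
def IsFiniteTransitive {A : Type*} {θ : A → A → Prop} (F : List (Set (TraceMonoid θ))) : Prop :=
  Nonempty (BisectionSeq θ F)

/-- A totally ordered family of submonoids is a factorization: every nontrivial element is
in exactly one way a product `m₁ ⋯ mₙ` of nontrivial elements of members of the family with
increasing indices. -/
def IsFactorization {M I : Type*} [Monoid M] [LinearOrder I] (N : I → Submonoid M) : Prop :=
  ∀ m : M, m ≠ 1 → ∃! l : List (I × M),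
    l.Pairwise (fun p q => p.1 < q.1) ∧ (∀ p ∈ l, p.2 ∈ N p.1 ∧ p.2 ≠ 1) ∧
      (l.map Prod.snd).prod = m

/-- `Y` is a minimal generating set (of the submonoid that it generates). -/
def IsMinimalGenerating {M : Type*} [Monoid M] (Y : Set M) : Prop :=
  ∀ y ∈ Y, y ∉ Submonoid.closure (Y \ {y})

/-- The finite sequence `F` coincides with the family `Y` on `B^{≤ n}`, up to terms of `Y` that
do not meet `B^{≤ n}`. -/
def AgreesOn {A I : Type*} [LinearOrder I] {θ : A → A → Prop} (Y : I → Set (TraceMonoid θ))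
    (B : Set A) (n : ℕ) (F : List (Set (TraceMonoid θ))) : Prop :=
  ∃ φ : Fin F.length → I, StrictMono φ ∧
    (∀ k, F.get k ∩ boundedTraces θ B n = Y (φ k) ∩ boundedTraces θ B n) ∧
    ∀ i, i ∉ Set.range φ → Y i ∩ boundedTraces θ B n = ∅

/-- `(Y i)` is (the family of the minimal generating sets of) a factorization of `M(A, θ)`
that is locally finite transitive. -/
structure IsLocallyFiniteTransitive {A I : Type*} [LinearOrder I] {θ : A → A → Prop}
    (Y : I → Set (TraceMonoid θ)) : Prop where
  minimal : ∀ i, IsMinimalGenerating (Y i)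
  factorization : IsFactorization (fun i => Submonoid.closure (Y i))
  locally_transitive : ∀ B : Set A, B.Finite → ∀ n : ℕ,
    ∃ F : List (Set (TraceMonoid θ)), IsFiniteTransitive F ∧ AgreesOn Y B n F

/-- The algebra `K⟨A, θ⟩ = K[M(A, θ)]` of trace polynomials. -/
abbrev TraceAlgebra (K : Type*) [CommRing K] {A : Type*} (θ : A → A → Prop) : Type _ :=
  MonoidAlgebra K (TraceMonoid θ)

/-- The free partially commutative Lie algebra `L_K(A, θ)`, realised as the Lie subalgebra of
`K⟨A, θ⟩` generated by the letters. -/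
noncomputable abbrev LieTrace (K : Type*) [CommRing K] {A : Type*} (θ : A → A → Prop) :
    LieSubalgebra K (TraceAlgebra K θ) :=
  LieSubalgebra.lieSpan K (TraceAlgebra K θ)
    (Set.range fun a : A => MonoidAlgebra.of K (TraceMonoid θ) (letter θ a))

/-- A letter, as an element of `L_K(A, θ)`. -/
noncomputable def lieLetter (K : Type*) [CommRing K] {A : Type*} (θ : A → A → Prop) (a : A) : LieTrace K θ :=
  ⟨MonoidAlgebra.of K (TraceMonoid θ) (letter θ a), LieSubalgebra.subset_lieSpan ⟨a, rfl⟩⟩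

/-- `[…[[x, v₁], v₂], …, vₖ]`. -/
def leftBracket {L : Type*} [LieRing L] (x : L) (v : List L) : L := v.foldl (fun u w => ⁅u, w⁆) x

/-- The restriction of `P` to `Cont F = ⋃ Yᵢ` is the bracketing `Π_f` of `F` along `f`.
(The values of `P` elsewhere play no role. As `Π_f` extends the bracketing `Π_{f'}` along the
sequence `f'` without its last bisection, one map `P` serves for both.) -/
def IsBracketingAlong (K : Type*) [CommRing K] {A : Type*} {θ : A → A → Prop}
    (P : TraceMonoid θ → LieTrace K θ) :
    {F : List (Set (TraceMonoid θ))} → BisectionSeq θ F → Prop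
  | _, .nil => ∀ a : A, P (letter θ a) = lieLetter K θ a
  | _, .comp (Y := Y) f T _ => IsBracketingAlong K P f ∧
      ∀ y ∈ Y \ T, ∀ v : List (TraceMonoid θ), (∀ x ∈ v, x ∈ T) → y * v.prod ∈ beta Y T →
        P (y * v.prod) = leftBracket (P y) (v.map P)

/-- `Q` is a bracketing of the locally finite transitive factorization `(Y i)`: on each `B^{≤ n}`
with `B` finite it agrees with the bracketing, along some sequence of transitive bisections, of
a finite transitive factorization that coincides there with `(Y i)`. -/
def IsBracketing (K : Type*) [CommRing K] {A I : Type*} [LinearOrder I] {θ : A → A → Prop}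
    (Y : I → Set (TraceMonoid θ)) (Q : (⋃ i, Y i : Set (TraceMonoid θ)) → LieTrace K θ) : Prop :=
  ∀ B : Set A, B.Finite → ∀ n : ℕ,
    ∃ (F : List (Set (TraceMonoid θ))) (f : BisectionSeq θ F) (P : TraceMonoid θ → LieTrace K θ),
      AgreesOn Y B n F ∧ IsBracketingAlong K P f ∧
        ∀ t, t.1 ∈ boundedTraces θ B n → Q t = P t.1

end TraceFact

namespace TraceFact

attribute [local instance] LieRing.ofAssociativeRing

/-! ### Trace monoids -/

/-! The theorem is a compactness argument. Along a finite transitive factorization, `Π_f(t)` is an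
iterated bracket of letters with the same letter content as `t`, and for a fixed content there are
only finitely many such Lie monomials (`finite_isLieMonomial`). So choose for each pair `(B, n)` a
finite factorization agreeing there and a bracketing of it. An ultrafilter on the directed set of
pairs gives every `t` a limit value `Q t`. As `B^{≤ n}` is finite, a single index `q ≥ (B, n)`
realises all limits on it simultaneously, and its factorization still agrees on the smaller set.

The other ingredient is that bracketings along `f` exist (`exists_isBracketingAlong`), that is, the
recursive formula is consistent. In `t = y v₁ ⋯ vₖ` the letter `y` is determined by the initial
alphabet. The `vᵢ` are determined up to the commutations of `θ_Y`, by the code property and left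
cancellation. Those commutations do not change the iterated bracket, because Lie monomials over
independent alphabets have zero bracket. Finally, an element of `β` already in the previous content
must lie in `Y`, which forces `k = 0`. -/

theorem hom_ext {A N : Type*} {θ : A → A → Prop} [Monoid N] {f g : TraceMonoid θ →* N}
    (h : ∀ a, f (letter θ a) = g (letter θ a)) : f = g :=
  PresentedMonoid.ext _ h

/-- Each letter acts on pairs `(w, e)`, where `e` is `w` with the first occurrence of `c` erased. -/
def eraseStep {A : Type*} [DecidableEq A] (θ : A → A → Prop) (c a : A) :
    Function.End (TraceMonoid θ × TraceMonoid θ) :=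
  fun p => (letter θ a * p.1, if a = c then p.1 else letter θ a * p.2)

theorem eraseStep_comm {A : Type*} [DecidableEq A] {θ : A → A → Prop} (c : A) {a b : A}
    (h : θ a b) : eraseStep θ c a * eraseStep θ c b = eraseStep θ c b * eraseStep θ c a := by
  funext p
  change eraseStep θ c a (eraseStep θ c b p) = eraseStep θ c b (eraseStep θ c a p)
  have hc := letter_comm h
  by_cases ha : a = c <;> by_cases hb : b = c <;>
    simp [eraseStep, ha, hb, ← mul_assoc, hc] <;> simp_all

/-- Applying the action `eraseStep` of `c * w` to `(1, 1)` recovers `w` as second component, so `w`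
is a function of `c * w`. -/
theorem letter_mul_left_cancel {A : Type*} {θ : A → A → Prop} {c : A} {s t : TraceMonoid θ}
    (h : letter θ c * s = letter θ c * t) : s = t := by
  classical
  let f := lift (eraseStep θ c) (fun _ _ => eraseStep_comm c)
  have hl : ∀ a, f (letter θ a) = eraseStep θ c a := lift_letter _ _
  have h1 : ∀ w, (f w (1, 1)).1 = w := by
    intro w
    induction w using trace_induction with
    | h1 => simp only [map_one]; rfl
    | hmul a t ih =>
      rw [map_mul, hl]
      change letter θ a * (f t (1, 1)).1 = _
      rw [ih]
  have h2 : ∀ w, (f (letter θ c * w) (1, 1)).2 = w := by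
    intro w
    rw [map_mul, hl]
    change (if c = c then (f w (1, 1)).1 else _) = _
    rw [if_pos rfl, h1]
  rw [← h2 s, h, h2]

theorem content_list_prod {A : Type*} {θ : A → A → Prop} (l : List (TraceMonoid θ)) :
    content l.prod = (l.map content).sum := by
  induction l with
  | nil => simp [content_one]
  | cons a l ih => simp [content_mul, ih]

theorem exists_list_letter {A : Type*} {θ : A → A → Prop} (t : TraceMonoid θ) :
    ∃ l : List A, (l.map (letter θ)).prod = t ∧ content t = l := by
  induction t using trace_induction with
  | h1 => exact ⟨[], by simp [content_one]⟩
  | hmul a t ih =>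
    obtain ⟨l, hl, hc⟩ := ih
    exact ⟨a :: l, by simp [hl], by simp [content_mul, content_letter, hc]⟩

theorem boundedTraces_finite {A : Type*} {θ : A → A → Prop} {B : Set A} (hB : B.Finite) (n : ℕ) :
    (boundedTraces θ B n).Finite := by
  have : Finite B := hB
  refine ((List.finite_length_le B n).image
    (fun l => (l.map (fun b : B => letter θ b)).prod)).subset ?_
  rintro t ⟨hB, hn⟩
  obtain ⟨l, hl, hc⟩ := exists_list_letter t
  have hlB : ∀ a ∈ l, a ∈ B := fun a ha => hB (by simpa [alph, hc] using ha)
  lift l to List B using hlB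
  refine ⟨l, by simpa [length, hc] using hn, by simpa using hl⟩

/-! ### Codes -/

section Codes

variable {A : Type*} {θ : A → A → Prop} {Y T : Set (TraceMonoid θ)}

theorem ofCode_letter (y : Y) : ofCode Y (letter (indepOn Y) y) = y.1 :=
  lift_letter _ _ _

theorem ofCode_prod (v : List Y) :
    ofCode Y (v.map (letter (indepOn Y))).prod = (v.map Subtype.val).prod := by
  simp [map_list_prod, List.map_map, Function.comp_def, ofCode_letter]

theorem isCode_range_letter (θ : A → A → Prop) : IsCode (Set.range (letter θ)) := by
  let g : TraceMonoid θ →* TraceMonoid (indepOn (Set.range (letter θ))) :=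
    lift (fun a => letter _ ⟨letter θ a, a, rfl⟩) (fun a b h => letter_comm (by
      simpa [indepOn, Indep, alph, content_letter] using h))
  have h : g.comp (ofCode _) = MonoidHom.id _ := by
    refine hom_ext ?_
    rintro ⟨_, a, rfl⟩
    simp only [MonoidHom.comp_apply, ofCode_letter, MonoidHom.id_apply]
    exact lift_letter _ _ _
  exact Function.LeftInverse.injective (g := g) (DFunLike.congr_fun h)

/-- The inclusion of `M(T, θ_T)` in `M(Y, θ_Y)` is injective, since deleting the letters outside `T`
is a retraction. -/
theorem IsCode.subset (hY : IsCode Y) (hT : T ⊆ Y) : IsCode T := by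
  classical
  let i : TraceMonoid (indepOn T) →* TraceMonoid (indepOn Y) :=
    lift (fun x => letter _ ⟨x.1, hT x.2⟩) (fun _ _ h => letter_comm h)
  let r : TraceMonoid (indepOn Y) →* TraceMonoid (indepOn T) :=
    lift (fun y => if h : y.1 ∈ T then letter _ ⟨y.1, h⟩ else 1) (fun a b h => by
      by_cases ha : a.1 ∈ T <;> by_cases hb : b.1 ∈ T <;> simp only [ha, hb, dite_true, dite_false,
        one_mul, mul_one]
      exact letter_comm h)
  have hr : r.comp i = MonoidHom.id _ := by
    refine hom_ext fun x => ?_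
    simp only [MonoidHom.comp_apply, MonoidHom.id_apply, i, r, lift_letter]
    simp
  have hi : (ofCode Y).comp i = ofCode T := by
    refine hom_ext fun x => ?_
    simp only [MonoidHom.comp_apply, i, lift_letter, ofCode_letter]
  have hinj : Function.Injective i := Function.LeftInverse.injective (g := r) (DFunLike.congr_fun hr)
  have := hY.comp hinj
  rwa [← MonoidHom.coe_comp, hi] at this

/-- In a code, the elements used in a product are determined with their multiplicities. -/
theorem IsCode.perm_of_prod_eq (hY : IsCode Y) {u v : List (TraceMonoid θ)} (hu : ∀ x ∈ u, x ∈ Y)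
    (hv : ∀ x ∈ v, x ∈ Y) (h : u.prod = v.prod) : u.Perm v := by
  lift u to List Y using hu
  lift v to List Y using hv
  rw [← ofCode_prod, ← ofCode_prod] at h
  have := congrArg content (hY h)
  simp only [content_list_prod, List.map_map, Function.comp_def, content_letter] at this
  have key : ∀ l : List Y, (l.map (fun y => ({y} : Multiset Y))).sum = l := by
    intro l
    induction l with
    | nil => rfl
    | cons a l ih => simp [ih]
  rw [key, key, Multiset.coe_eq_coe] at this
  exact this.map _

theorem IsCode.eq_of_eq_mul (hY : IsCode Y) {y z : TraceMonoid θ} (hy : y ∈ Y) (hz : z ∈ Y)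
    {v : List (TraceMonoid θ)} (hv : ∀ x ∈ v, x ∈ Y) (h : y = z * v.prod) : y = z ∧ v = [] := by
  have hp := hY.perm_of_prod_eq (u := [y]) (v := z :: v) (by simpa) (by simpa [hz] using hv)
    (by simpa using h)
  have := List.perm_singleton.1 hp.symm
  simp only [List.cons.injEq] at this
  exact ⟨this.1.symm, this.2⟩

/-- These are the elements with `w = 1`. Hence a bisection never removes anything from the content
(`cont_subset_comp`). -/
theorem IsCode.diff_subset_beta (hY : IsCode Y) : Y \ T ⊆ beta Y T := by
  intro y hy
  refine ⟨y, hy, 1, one_mem _, by simp, ?_⟩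
  ext z
  simp only [initialAlph, Set.mem_ofPred_eq, Set.mem_singleton_iff]
  constructor
  · rintro ⟨hz, w, hw, h⟩
    obtain ⟨v, hv, rfl⟩ := Submonoid.exists_list_of_mem_closure hw
    exact (hY.eq_of_eq_mul hy.1 hz hv h).1.symm
  · rintro rfl
    exact ⟨hy.1, 1, one_mem _, by simp⟩

theorem exists_of_mem_beta {t : TraceMonoid θ} (ht : t ∈ beta Y T) :
    ∃ y ∈ Y \ T, ∃ v : List (TraceMonoid θ), (∀ x ∈ v, x ∈ T) ∧ t = y * v.prod := by
  obtain ⟨z, hz, w, hw, rfl, -⟩ := ht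
  obtain ⟨v, hv, rfl⟩ := Submonoid.exists_list_of_mem_closure hw
  exact ⟨z, hz, v, hv, rfl⟩

theorem list_prod_mem_closure {v : List (TraceMonoid θ)} (hv : ∀ x ∈ v, x ∈ Y) :
    v.prod ∈ Submonoid.closure Y :=
  Submonoid.list_prod_mem _ fun x hx => Submonoid.subset_closure (hv x hx)

theorem beta_subset_closure (hT : T ⊆ Y) : beta Y T ⊆ Submonoid.closure Y := by
  intro t ht
  obtain ⟨y, hy, v, hv, rfl⟩ := exists_of_mem_beta ht
  exact mul_mem (Submonoid.subset_closure hy.1) (list_prod_mem_closure fun x hx => hT (hv x hx))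

theorem eq_of_mul_mem_beta (hT : T ⊆ Y) {y z : TraceMonoid θ} {u v : List (TraceMonoid θ)}
    (hy : y ∈ Y) (hz : z ∈ Y) (hu : ∀ x ∈ u, x ∈ T) (hv : ∀ x ∈ v, x ∈ T)
    (h : y * u.prod = z * v.prod) (hb : y * u.prod ∈ beta Y T) : y = z := by
  obtain ⟨x, -, w, -, -, hx⟩ := hb
  have h1 : y ∈ initialAlph Y (y * u.prod) :=
    ⟨hy, _, list_prod_mem_closure fun x hx => hT (hu x hx), rfl⟩
  have h2 : z ∈ initialAlph Y (y * u.prod) :=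
    ⟨hz, _, list_prod_mem_closure fun x hx => hT (hv x hx), h⟩
  rw [hx] at h1 h2
  exact h1.trans h2.symm

/-- A nonempty product over `β` uses a letter of `Y \ T`, a product over `T` uses none, and a code
determines the letters used. -/
theorem IsCode.disjoint_closure (hY : IsCode Y) (hT : T ⊆ Y) {t : TraceMonoid θ}
    (h1 : t ∈ Submonoid.closure T) (h2 : t ∈ Submonoid.closure (beta Y T)) : t = 1 := by
  obtain ⟨u, hu, rfl⟩ := Submonoid.exists_list_of_mem_closure h1
  obtain ⟨v, hv, h⟩ := Submonoid.exists_list_of_mem_closure h2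
  cases v with
  | nil => simpa using h.symm
  | cons b v =>
    obtain ⟨y, hy, w, hw, rfl⟩ := exists_of_mem_beta (hv b (by simp))
    have hm : v.prod ∈ Submonoid.closure Y :=
      Submonoid.closure_le.2 (beta_subset_closure hT)
        (list_prod_mem_closure fun x hx => hv x (by simp [hx]))
    obtain ⟨v', hv', h'⟩ := Submonoid.exists_list_of_mem_closure hm
    have hp := hY.perm_of_prod_eq (u := u) (v := y :: (w ++ v')) (fun x hx => hT (hu x hx))
      (by
        intro x hx
        simp only [List.mem_cons, List.mem_append] at hx
        rcases hx with rfl | hx | hx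
        · exact hy.1
        · exact hT (hw x hx)
        · exact hv' x hx)
      (by simp [← h, h', mul_assoc])
    exact absurd (hu y (hp.mem_iff.2 (by simp))) hy.2

end Codes

/-! ### Finite transitive factorizations -/

section Finite

variable {A : Type*} {θ : A → A → Prop}

/-- `Cont F`, the union of the terms of `F`. -/
def cont (F : List (Set (TraceMonoid θ))) : Set (TraceMonoid θ) := {t | ∃ Y ∈ F, t ∈ Y}

theorem BisectionSeq.isCode {F : List (Set (TraceMonoid θ))} (f : BisectionSeq θ F) :
    ∀ Y ∈ F, IsCode Y := by
  induction f with
  | nil => simpa using isCode_range_letter θ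
  | @comp pre post Y f T hT ih =>
    intro X hX
    simp only [List.mem_append, List.mem_cons] at hX
    rcases hX with hX | rfl | rfl | hX
    · exact ih X (by simp [hX])
    · exact (ih Y (by simp)).subset hT.1
    · exact hT.2
    · exact ih X (by simp [hX])

/-- Both new submonoids lie in `⟨Y⟩`, so the only new pair to check is `T` against `β`. -/
theorem BisectionSeq.pairwise_disjoint {F : List (Set (TraceMonoid θ))} (f : BisectionSeq θ F) :
    F.Pairwise fun Y Z => ∀ t ∈ Submonoid.closure Y, t ∈ Submonoid.closure Z → t = 1 := by
  induction f with
  | nil => simp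
  | @comp pre post Y f T hT ih =>
    have hb := Submonoid.closure_le.2 (beta_subset_closure hT.1)
    have ht := Submonoid.closure_mono hT.1
    simp only [List.pairwise_append, List.pairwise_cons, List.mem_cons] at ih ⊢
    obtain ⟨h1, ⟨h2, h3⟩, h4⟩ := ih
    refine ⟨h1, ⟨?_, ?_, h3⟩, ?_⟩
    · rintro X (rfl | hX) t h h'
      · exact (f.isCode Y (by simp)).disjoint_closure hT.1 h h'
      · exact h2 X hX t (ht h) h'
    · exact fun X hX t h h' => h2 X hX t (hb h) h'
    · rintro X hX Z (rfl | rfl | hZ) t h h'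
      · exact h4 X hX Y (Or.inl rfl) t h (ht h')
      · exact h4 X hX Y (Or.inl rfl) t h (hb h')
      · exact h4 X hX Z (Or.inr hZ) t h h'

theorem cont_subset_comp {pre post : List (Set (TraceMonoid θ))} {Y T : Set (TraceMonoid θ)}
    (hY : IsCode Y) : cont (pre ++ Y :: post) ⊆ cont (pre ++ T :: beta Y T :: post) := by
  rintro t ⟨X, hX, ht⟩
  simp only [List.mem_append, List.mem_cons] at hX
  rcases hX with hX | rfl | hX
  · exact ⟨X, by simp [hX], ht⟩
  · by_cases h : t ∈ T
    · exact ⟨T, by simp, h⟩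
    · exact ⟨beta X T, by simp, hY.diff_subset_beta ⟨ht, h⟩⟩
  · exact ⟨X, by simp [hX], ht⟩

theorem cont_comp_subset {pre post : List (Set (TraceMonoid θ))} {Y T : Set (TraceMonoid θ)}
    (hT : T ⊆ Y) : cont (pre ++ T :: beta Y T :: post) ⊆ cont (pre ++ Y :: post) ∪ beta Y T := by
  rintro t ⟨X, hX, ht⟩
  simp only [List.mem_append, List.mem_cons] at hX
  rcases hX with hX | rfl | rfl | hX
  · exact Or.inl ⟨X, by simp [hX], ht⟩
  · exact Or.inl ⟨Y, by simp, hT ht⟩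
  · exact Or.inr ht
  · exact Or.inl ⟨X, by simp [hX], ht⟩

/-- The elements of `Cont F` inside `⟨Y⟩`, for a term `Y` of `F`, lie in `Y`. -/
theorem BisectionSeq.mem_of_mem_cont {pre post : List (Set (TraceMonoid θ))}
    {Y : Set (TraceMonoid θ)} (f : BisectionSeq θ (pre ++ Y :: post)) {t : TraceMonoid θ}
    (ht : t ∈ cont (pre ++ Y :: post)) (hc : t ∈ Submonoid.closure Y) (h1 : t ≠ 1) : t ∈ Y := by
  have hp := f.pairwise_disjoint
  simp only [List.pairwise_append, List.pairwise_cons, List.mem_cons] at hp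
  obtain ⟨X, hX, hx⟩ := ht
  simp only [List.mem_append, List.mem_cons] at hX
  rcases hX with hX | rfl | hX
  · exact absurd (hp.2.2 X hX Y (Or.inl rfl) t (Submonoid.subset_closure hx) hc) h1
  · exact hx
  · exact absurd (hp.2.1.1 X hX t hc (Submonoid.subset_closure hx)) h1

end Finite
/-! ### Lie monomials -/

section Monomials

variable (K : Type*) [CommRing K] {A : Type*} (θ : A → A → Prop)

/-- `x` is an iterated bracket of letters, in which the letters occur as prescribed by `m`. -/
inductive IsLieMonomial : Multiset A → LieTrace K θ → Prop
  | letter (a : A) : IsLieMonomial {a} (lieLetter K θ a)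
  | lie {m n : Multiset A} {x y : LieTrace K θ} :
      IsLieMonomial m x → IsLieMonomial n y → IsLieMonomial (m + n) ⁅x, y⁆

variable {K θ}

theorem IsLieMonomial.ne_zero {m : Multiset A} {x : LieTrace K θ} (h : IsLieMonomial K θ m x) :
    m ≠ 0 := by
  induction h with
  | letter a => simp
  | lie _ _ h _ => simp [h]

/-- The outermost bracket splits `m` into two nonzero, hence strictly smaller, parts, and `m` has
finitely many splittings. -/
theorem finite_isLieMonomial (m : Multiset A) : {x | IsLieMonomial K θ m x}.Finite := by
  induction m using Multiset.strongInductionOn with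
  | ih m ih =>
    have h1 : {x | ∃ a, m = {a} ∧ x = lieLetter K θ a}.Finite := by
      refine Set.Subsingleton.finite ?_
      rintro _ ⟨a, ha, rfl⟩ _ ⟨b, hb, rfl⟩
      rw [ha, Multiset.singleton_inj] at hb
      rw [hb]
    have h2 : (⋃ p ∈ {p : Multiset A × Multiset A | p ∈ Multiset.antidiagonal m ∧
        p.1 ≠ 0 ∧ p.2 ≠ 0}, Set.image2 (fun x y : LieTrace K θ => ⁅x, y⁆)
          {x | IsLieMonomial K θ p.1 x} {x | IsLieMonomial K θ p.2 x}).Finite := by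
      refine Set.Finite.biUnion ?_ ?_
      · classical
        exact (Multiset.antidiagonal m).toFinset.finite_toSet.subset fun p hp => by
          simpa using hp.1
      · rintro ⟨p, q⟩ ⟨hm, hp, hq⟩
        rw [Multiset.mem_antidiagonal] at hm
        simp only at hm hp hq
        subst hm
        refine (ih p ?_).image2 _ (ih q ?_)
        · exact lt_add_of_pos_right _ (pos_iff_ne_zero.2 hq)
        · exact lt_add_of_pos_left _ (pos_iff_ne_zero.2 hp)
    refine (h1.union h2).subset ?_
    intro x hx
    cases hx with
    | letter a => exact Or.inl ⟨a, rfl, rfl⟩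
    | @lie p q x y hx hy =>
      refine Or.inr (Set.mem_biUnion (x := (p, q)) ⟨?_, hx.ne_zero, hy.ne_zero⟩ ⟨x, hx, y, hy, rfl⟩)
      simp

/-- By the Jacobi identity the centraliser of `y` is closed under brackets. -/
theorem IsLieMonomial.lie_eq_zero_of_letter {m : Multiset A} {x y : LieTrace K θ}
    (h : IsLieMonomial K θ m x) (hy : ∀ a ∈ m, ⁅lieLetter K θ a, y⁆ = 0) : ⁅x, y⁆ = 0 := by
  induction h with
  | letter a => exact hy a (by simp)
  | lie _ _ h1 h2 =>
    rw [lie_lie, h1 fun a ha => hy a (by simp [ha]), h2 fun a ha => hy a (by simp [ha])]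
    simp

theorem lie_lieLetter {a b : A} (h : θ a b) : ⁅lieLetter K θ a, lieLetter K θ b⁆ = 0 := by
  apply Subtype.ext
  simp only [lieLetter, LieSubalgebra.coe_bracket, LieRing.of_associative_ring_bracket,
    ← map_mul, letter_comm h, sub_self]
  rfl

theorem IsLieMonomial.lie_eq_zero {m n : Multiset A} {x y : LieTrace K θ}
    (hx : IsLieMonomial K θ m x) (hy : IsLieMonomial K θ n y) (h : ∀ a ∈ m, ∀ b ∈ n, θ a b) :
    ⁅x, y⁆ = 0 := by
  refine hx.lie_eq_zero_of_letter fun a ha => ?_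
  rw [← lie_skew, hy.lie_eq_zero_of_letter, neg_zero]
  intro b hb
  rw [← lie_skew, lie_lieLetter (h a ha b hb), neg_zero]

theorem IsLieMonomial.leftBracket {m : Multiset A} {x : LieTrace K θ} (hx : IsLieMonomial K θ m x)
    {P : TraceMonoid θ → LieTrace K θ} (v : List (TraceMonoid θ))
    (hv : ∀ t ∈ v, IsLieMonomial K θ (content t) (P t)) :
    IsLieMonomial K θ (m + content v.prod) (leftBracket x (v.map P)) := by
  induction v generalizing m x with
  | nil => simpa [content_one, TraceFact.leftBracket] using hx
  | cons t v ih =>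
    rw [List.prod_cons, content_mul, ← add_assoc]
    exact ih (hx.lie (hv t (by simp))) fun s hs => hv s (by simp [hs])

end Monomials

/-! ### Bracketings of finite transitive factorizations -/

section Bracketing

variable {K : Type*} [CommRing K] {A : Type*} {θ : A → A → Prop}

theorem lie_lie_comm {L : Type*} [LieRing L] {x p q : L} (h : ⁅p, q⁆ = 0) :
    ⁅⁅x, p⁆, q⁆ = ⁅⁅x, q⁆, p⁆ := by
  have := leibniz_lie x p q
  rw [h, lie_zero, ← lie_skew p ⁅x, q⁆] at this
  exact add_neg_eq_zero.1 this.symm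

/-- An iterated bracket depends only on the trace of the list of its arguments. -/
theorem leftBracket_congr {X L : Type*} [LieRing L] {ρ : X → X → Prop} {P : X → L}
    (hP : ∀ a b, ρ a b → ⁅P a, P b⁆ = 0) {u v : List X}
    (h : (u.map (letter ρ)).prod = (v.map (letter ρ)).prod) (x : L) :
    leftBracket x (u.map P) = leftBracket x (v.map P) := by
  -- The opposite monoid appears because the first letter of a word is bracketed first.
  let g : TraceMonoid ρ →* (Function.End L)ᵐᵒᵖ :=
    lift (fun a => MulOpposite.op (fun x => ⁅x, P a⁆ : L → L)) (fun a b hab => by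
      refine congrArg MulOpposite.op (funext fun x => ?_)
      exact lie_lie_comm (hP a b hab))
  have key : ∀ (w : List X) (x : L),
      (g (w.map (letter ρ)).prod).unop x = leftBracket x (w.map P) := by
    intro w
    induction w with
    | nil => intro x; simp only [List.map_nil, List.prod_nil, map_one]; rfl
    | cons a w ih =>
      intro x
      rw [List.map_cons, List.prod_cons, map_mul, MulOpposite.unop_mul]
      change (g _).unop ((g (letter ρ a)).unop x) = _
      rw [ih]
      simp only [g, lift_letter]
      rfl
  rw [← key, ← key, h]

/-- The code property lifts the equation to `M(Y, θ_Y)`, where the letter `y` can be cancelled. -/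
theorem leftBracket_congr_of_isCode {Y : Set (TraceMonoid θ)} (hY : IsCode Y)
    {P : TraceMonoid θ → LieTrace K θ} (hP : ∀ t ∈ Y, IsLieMonomial K θ (content t) (P t))
    {y : TraceMonoid θ} (hy : y ∈ Y) {u v : List (TraceMonoid θ)} (hu : ∀ x ∈ u, x ∈ Y)
    (hv : ∀ x ∈ v, x ∈ Y) (h : y * u.prod = y * v.prod) (x : LieTrace K θ) :
    leftBracket x (u.map P) = leftBracket x (v.map P) := by
  lift y to Y using hy
  lift u to List Y using hu
  lift v to List Y using hv
  rw [← ofCode_prod, ← ofCode_prod, ← ofCode_letter, ← map_mul, ← map_mul] at h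
  have := leftBracket_congr (P := fun y : Y => P y.1)
    (fun a b hab => (hP a a.2).lie_eq_zero (hP b b.2) hab) (letter_mul_left_cancel (hY h)) x
  simpa [Function.comp_def] using this

theorem IsBracketingAlong.congr {F : List (Set (TraceMonoid θ))} {f : BisectionSeq θ F}
    {P Q : TraceMonoid θ → LieTrace K θ} (hP : IsBracketingAlong K P f)
    (h : ∀ t ∈ cont F, Q t = P t) : IsBracketingAlong K Q f := by
  induction f with
  | nil =>
    intro a
    rw [h _ ⟨_, List.mem_singleton_self _, a, rfl⟩]
    exact hP a
  | @comp pre post Y f T hT ih =>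
    have hs := cont_subset_comp (pre := pre) (post := post) (T := T) (f.isCode Y (by simp))
    have hY : ∀ t ∈ Y, Q t = P t := fun t ht => h t (hs ⟨Y, by simp, ht⟩)
    refine ⟨ih hP.1 fun t ht => h t (hs ht), fun y hy v hv hb => ?_⟩
    rw [h _ ⟨_, by simp, hb⟩, hP.2 y hy v hv hb, hY y hy.1,
      List.map_congr_left fun x hx => (hY x (hT.1 (hv x hx))).symm]

theorem exists_isBracketingAlong (K : Type*) [CommRing K] {F : List (Set (TraceMonoid θ))}
    (f : BisectionSeq θ F) : ∃ P : TraceMonoid θ → LieTrace K θ, IsBracketingAlong K P f ∧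
      ∀ t ∈ cont F, IsLieMonomial K θ (content t) (P t) := by
  classical
  induction f with
  | nil =>
    have hinj : Function.Injective (letter θ) := fun a b h => by
      simpa [content_letter] using congrArg content h
    refine ⟨fun t => if h : ∃ a, letter θ a = t then lieLetter K θ h.choose else 0, ?_, ?_⟩
    · intro a
      have h : ∃ b, letter θ b = letter θ a := ⟨a, rfl⟩
      simp only [dif_pos h, hinj h.choose_spec]
    · rintro t ⟨X, hX, ht⟩
      rw [List.mem_singleton] at hX
      subst hX
      have h : ∃ a, letter θ a = t := ht
      simp only [dif_pos h]
      conv => enter [3]; rw [← h.choose_spec, content_letter]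
      exact .letter _
  | @comp pre post Y f T hT ih =>
    obtain ⟨P, hP, hm⟩ := ih
    have hY := f.isCode Y (by simp)
    have hmY : ∀ t ∈ Y, IsLieMonomial K θ (content t) (P t) := fun t ht => hm t ⟨Y, by simp, ht⟩
    let D (t : TraceMonoid θ) (p : TraceMonoid θ × List (TraceMonoid θ)) : Prop :=
      p.1 ∈ Y \ T ∧ (∀ x ∈ p.2, x ∈ T) ∧ t = p.1 * p.2.prod
    -- Old values take precedence; otherwise an arbitrary decomposition is chosen. The value `0` is
    -- never used on the content.
    let Q (t : TraceMonoid θ) : LieTrace K θ :=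
      if t ∈ cont (pre ++ Y :: post) then P t else
      if h : ∃ p, D t p then leftBracket (P h.choose.1) (h.choose.2.map P) else 0
    have hQP : ∀ t ∈ cont (pre ++ Y :: post), Q t = P t := fun t ht => if_pos ht
    have hQ : ∀ y ∈ Y \ T, ∀ v : List (TraceMonoid θ), (∀ x ∈ v, x ∈ T) → y * v.prod ∈ beta Y T →
        Q (y * v.prod) = leftBracket (P y) (v.map P) := by
      intro y hy v hv hb
      have hvY : ∀ x ∈ v, x ∈ Y := fun x hx => hT.1 (hv x hx)
      by_cases hc : y * v.prod ∈ cont (pre ++ Y :: post)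
      · have h1 : y * v.prod ≠ 1 := fun h => by
          simpa using hY.perm_of_prod_eq (u := y :: v) (v := []) (by simpa [hy.1] using hvY)
            (by simp) (by simpa using h)
        -- Overlap with the old content: the product is itself a letter of the code `Y`, so `v` is
        -- empty and both prescriptions give `P y`.
        have hyv := f.mem_of_mem_cont hc (beta_subset_closure hT.1 hb) h1
        obtain ⟨-, rfl⟩ := hY.eq_of_eq_mul hyv hy.1 hvY rfl
        rw [hQP _ hc]
        simp [leftBracket]
      · have h : ∃ p, D (y * v.prod) p := ⟨(y, v), hy, hv, rfl⟩
        have hQh : Q (y * v.prod) = leftBracket (P h.choose.1) (h.choose.2.map P) := by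
          simp only [Q, if_neg hc, dif_pos h]
        rw [hQh]
        obtain ⟨h1, h2, h3⟩ := h.choose_spec
        generalize h.choose = p at h1 h2 h3
        obtain ⟨z, u⟩ := p
        simp only at h1 h2 h3 ⊢
        obtain rfl := eq_of_mul_mem_beta hT.1 hy.1 h1.1 hv h2 h3 hb
        exact leftBracket_congr_of_isCode hY hmY hy.1 (fun x hx => hT.1 (h2 x hx)) hvY h3.symm _
    refine ⟨Q, ⟨hP.congr hQP, fun y hy v hv hb => ?_⟩, fun t ht => ?_⟩
    · rw [hQ y hy v hv hb, hQP y ⟨Y, by simp, hy.1⟩,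
        List.map_congr_left fun x hx => (hQP x ⟨Y, by simp, hT.1 (hv x hx)⟩).symm]
    · rcases cont_comp_subset hT.1 ht with ht | ht
      · rw [hQP t ht]
        exact hm t ht
      · obtain ⟨y, hy, v, hv, rfl⟩ := exists_of_mem_beta ht
        rw [hQ y hy v hv ht, content_mul]
        exact (hmY y hy.1).leftBracket v fun x hx => hmY x (hT.1 (hv x hx))

end Bracketing

/-! ### Compactness -/

section Compactness

open Filter

variable {A I : Type*} [LinearOrder I] {θ : A → A → Prop} {Y : I → Set (TraceMonoid θ)}

/-- The same `φ` works: indices outside its range meet the smaller set even less. -/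
theorem AgreesOn.mono {B B' : Set A} {n n' : ℕ} {F : List (Set (TraceMonoid θ))}
    (h : AgreesOn Y B' n' F) (hB : B ⊆ B') (hn : n ≤ n') : AgreesOn Y B n F := by
  have hs : boundedTraces θ B n ⊆ boundedTraces θ B' n' :=
    fun t ht => ⟨ht.1.trans hB, ht.2.trans hn⟩
  obtain ⟨φ, h1, h2, h3⟩ := h
  refine ⟨φ, h1, fun k => ?_, fun i hi => ?_⟩
  · rw [← Set.inter_eq_right.2 hs, ← Set.inter_assoc, h2 k, Set.inter_assoc]
  · exact Set.subset_eq_empty (Set.inter_subset_inter_right _ hs) (h3 i hi)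

theorem AgreesOn.mem_cont {B : Set A} {n : ℕ} {F : List (Set (TraceMonoid θ))}
    (h : AgreesOn Y B n F) {t : TraceMonoid θ} (ht : t ∈ ⋃ i, Y i)
    (hb : t ∈ boundedTraces θ B n) : t ∈ cont F := by
  obtain ⟨φ, -, h2, h3⟩ := h
  obtain ⟨i, hi⟩ := Set.mem_iUnion.1 ht
  by_cases hr : i ∈ Set.range φ
  · obtain ⟨k, rfl⟩ := hr
    have : t ∈ F.get k ∩ boundedTraces θ B n := by rw [h2 k]; exact ⟨hi, hb⟩
    exact ⟨_, F.get_mem k, this.1⟩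
  · have : t ∈ Y i ∩ boundedTraces θ B n := ⟨hi, hb⟩
    rw [h3 i hr] at this
    exact this.elim

theorem exists_isBracketing (K : Type*) [CommRing K] (hY : ∀ B : Set A, B.Finite → ∀ n : ℕ,
      ∃ F : List (Set (TraceMonoid θ)), IsFiniteTransitive F ∧ AgreesOn Y B n F) :
    ∃ Q : (⋃ i, Y i : Set (TraceMonoid θ)) → LieTrace K θ, IsBracketing K Y Q := by
  classical
  have key : ∀ p : Finset A × ℕ, ∃ (F : List (Set (TraceMonoid θ))) (f : BisectionSeq θ F)
      (P : TraceMonoid θ → LieTrace K θ), AgreesOn Y p.1 p.2 F ∧ IsBracketingAlong K P f ∧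
        ∀ t ∈ cont F, IsLieMonomial K θ (content t) (P t) := by
    intro p
    obtain ⟨F, ⟨f⟩, hF⟩ := hY p.1 p.1.finite_toSet p.2
    obtain ⟨P, hP⟩ := exists_isBracketingAlong K f
    exact ⟨F, f, P, hF, hP⟩
  choose F f P hF hP hm using key
  -- Being finer than `atTop`, it contains every cone `{q | p ≤ q}`.
  let U : Ultrafilter (Finset A × ℕ) := Ultrafilter.of atTop
  have hU : ∀ p : Finset A × ℕ, ∀ᶠ q in (U : Filter (Finset A × ℕ)), p ≤ q :=
    fun p => Ultrafilter.of_le atTop (eventually_ge_atTop p)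
  have hlim : ∀ t : (⋃ i, Y i : Set (TraceMonoid θ)), ∃ x : LieTrace K θ,
      ∀ᶠ q in (U : Filter (Finset A × ℕ)), P q t = x := by
    intro t
    -- As soon as `q` dominates the alphabet and length of `t`, `P q t` lies in a finite set
    -- independent of `q`; the ultrafilter then selects one value.
    have : ∀ᶠ q in (U : Filter (Finset A × ℕ)),
        ∃ x ∈ {x | IsLieMonomial K θ (content t.1) x}, P q t = x := by
      filter_upwards [hU ((content t.1).toFinset, length t.1)] with q hq
      refine ⟨_, hm q t.1 ((hF q).mem_cont t.2 ⟨fun a ha => ?_, hq.2⟩), rfl⟩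
      exact hq.1 (Multiset.mem_toFinset.2 ha)
    obtain ⟨x, -, hx⟩ := (Ultrafilter.eventually_exists_mem_iff (finite_isLieMonomial _)).1 this
    exact ⟨x, hx⟩
  choose Q hQ using hlim
  refine ⟨Q, fun B hB n => ?_⟩
  have hfin : {t : (⋃ i, Y i : Set (TraceMonoid θ)) | t.1 ∈ boundedTraces θ B n}.Finite :=
    (boundedTraces_finite hB n).preimage Subtype.val_injective.injOn
  -- Finitely many eventual equalities and one cone have a common index.
  obtain ⟨q, hq, hle⟩ :=
    (((Filter.eventually_all_finite hfin).2 fun t _ => hQ t).and (hU (hB.toFinset, n))).exists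
  exact ⟨F q, f q, P q, (hF q).mono (fun a ha => hle.1 (by simpa using ha)) hle.2, hP q,
    fun t ht => (hq t ht).symm⟩

end Compactness

end TraceFact

theorem mainTheorem4 {K : Type*} [CommRing K] {A : Type*} (θ : A → A → Prop)
    (hirrefl : ∀ a, ¬ θ a a) (hsymm : ∀ a b, θ a b → θ b a)
    {I : Type*} [LinearOrder I] (Y : I → Set (TraceFact.TraceMonoid θ))
    (hY : TraceFact.IsLocallyFiniteTransitive Y) :
    ∃ Q : (⋃ i, Y i : Set (TraceFact.TraceMonoid θ)) → TraceFact.LieTrace K θ,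
      TraceFact.IsBracketing K Y Q :=
  TraceFact.exists_isBracketing K hY.locally_transitive
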